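/- For an integer $x\ge 0$ let $p(x)$ be the number of partitions of $x$, and put $p(x)=0$ for every integer $x<0$. Let $b_6(n)$ be the number of $6$-regular partitions of $n$, that is, partitions of $n$ with no part divisible by $6$. Then for all integers $n\ge 0$ and $k>0$, $$(-1)^k\left(b_6(n)-\sum_{j=-(k-1)}^{k}(-1)^j\,p\bigl(n-3j(3j-1)\bigr)\right)\ge 0,$$ with strict inequality if $n\ge 3k(3k+1)$. In particular, for all integers $n\ge 0$, $$p(n)-p(n-6)-p(n-12)+p(n-30)\le b_6(n)\le p(n)-p(n-6).$$ -/

import Mathlib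

/-- Euler's partition function, extended to the integers: `partitionCount x` is the number of
partitions of `x` if `x ≥ 0`, and `0` if `x < 0`. -/
def partitionCount (x : ℤ) : ℕ :=
  if 0 ≤ x then Fintype.card (Nat.Partition x.toNat) else 0

/-- The number of `ℓ`-regular partitions of `n`: those with no part divisible by `ℓ`. -/
def regularPartitionCount (ℓ n : ℕ) : ℕ :=
  (Nat.Partition.restricted n (fun i => ¬ ℓ ∣ i)).card

/-- `(-1)^k (b₆(n) - ∑_{j=-(k-1)}^{k} (-1)^j p(n - 3j(3j-1)))`. -/
noncomputable def truncatedDifference (k n : ℕ) : ℤ :=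
  (-1) ^ k * ((regularPartitionCount 6 n : ℤ) -
    ∑ j ∈ Finset.Icc (-((k : ℤ) - 1)) (k : ℤ),
      (Int.negOnePow j : ℤ) * (partitionCount ((n : ℤ) - 3 * j * (3 * j - 1)) : ℤ))

open PowerSeries

namespace TruncatedPentagonal

open scoped PowerSeries.WithPiTopology

/-! Put `Q = X ^ 6`. Removing the parts divisible by 6 multiplies the partition series by `(Q;
Q)_∞`, and the pentagonal number theorem expands this product. Truncating the expansion and
multiplying by `1 / (Q; Q)_∞` (which is `eulerSum Q 1`) gives 1 plus a signed monomial times `tail Q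
k` (`truncated_pentagonal`, by induction from `tail_add_tail_succ`). Multiplied by the series of
`b₆`, the error has nonnegative coefficients up to sign; it is strictly positive from the degree of
the monomial on, since the tail has constant term 1 and `b₆` is positive. `R = X ^ 3` is a square
root of `Q`, so that pentagonal exponents need no halving. -/

/-- The inverse `1 / (1 - Q ^ i)` as a geometric series. -/
noncomputable def geom (Q : ℤ⟦X⟧) (i : ℕ) : ℤ⟦X⟧ := ∑' j : ℕ, (Q ^ i) ^ j

/-- The inverse `1 / (Q; Q)_m` of the finite `q`-Pochhammer symbol. -/
noncomputable def invPochhammer (Q : ℤ⟦X⟧) (m : ℕ) : ℤ⟦X⟧ :=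
  ∏ i ∈ Finset.range m, geom Q (i + 1)

/-- Euler's series `∑ Q ^ (j m) / (Q; Q)_m`. -/
noncomputable def eulerSum (Q : ℤ⟦X⟧) (j : ℕ) : ℤ⟦X⟧ :=
  ∑' m : ℕ, Q ^ (j * m) * invPochhammer Q m

/-- The tail of the truncated pentagonal number series of Andrews and Merca, without its leading
monomial. -/
noncomputable def tail (Q : ℤ⟦X⟧) (k : ℕ) : ℤ⟦X⟧ :=
  invPochhammer Q k * ∑' m : ℕ, Q ^ ((k + 2) * m) * (geom Q (m + k + 1) * invPochhammer Q m)

/-! ### Euler's expansion of `1 / (Q; Q)_∞` -/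

theorem summable_of_X_pow_dvd {f : ℕ → ℤ⟦X⟧} (h : ∀ m, X ^ m ∣ f m) : Summable f := by
  apply WithPiTopology.summable_of_tendsto_order_atTop_nhds_top
  refine ENat.tendsto_nhds_top_iff_natCast_lt.mpr fun n => Filter.eventually_atTop.mpr
    ⟨n + 1, fun m hm => ?_⟩
  refine lt_of_lt_of_le ?_ (le_order (f m) m fun i hi =>
    X_pow_dvd_iff.mp (h m) i (by exact_mod_cast hi))
  exact_mod_cast hm

theorem X_pow_dvd_pow_mul {Q : ℤ⟦X⟧} (hQ : X ∣ Q) {j : ℕ} (hj : 1 ≤ j) (m : ℕ) (f : ℤ⟦X⟧) :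
    X ^ m ∣ Q ^ (j * m) * f :=
  Dvd.dvd.mul_right ((pow_dvd_pow_of_dvd hQ m).trans (pow_dvd_pow Q (Nat.le_mul_of_pos_left m hj))) f

theorem summable_pow_mul {Q : ℤ⟦X⟧} (hQ : X ∣ Q) {j : ℕ} (hj : 1 ≤ j) (f : ℕ → ℤ⟦X⟧) :
    Summable fun m => Q ^ (j * m) * f m :=
  summable_of_X_pow_dvd fun m => X_pow_dvd_pow_mul hQ hj m (f m)

theorem geom_mul {Q : ℤ⟦X⟧} (hQ : X ∣ Q) {i : ℕ} (hi : i ≠ 0) : geom Q i * (1 - Q ^ i) = 1 := by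
  apply WithPiTopology.tsum_pow_mul_one_sub_of_constantCoeff_eq_zero
  exact X_dvd_iff.mp (hQ.trans (dvd_pow_self Q hi))

theorem invPochhammer_zero (Q : ℤ⟦X⟧) : invPochhammer Q 0 = 1 := by simp [invPochhammer]

theorem invPochhammer_succ (Q : ℤ⟦X⟧) (m : ℕ) :
    invPochhammer Q (m + 1) = invPochhammer Q m * geom Q (m + 1) :=
  Finset.prod_range_succ _ _

theorem invPochhammer_succ_mul {Q : ℤ⟦X⟧} (hQ : X ∣ Q) (m : ℕ) :
    invPochhammer Q (m + 1) * (1 - Q ^ (m + 1)) = invPochhammer Q m := by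
  rw [invPochhammer_succ, mul_assoc, geom_mul hQ m.succ_ne_zero, mul_one]

/-- The factor `1 - Q ^ m` in the difference of the `m`-th terms cancels the last factor of `(Q;
Q)_m`; shifting `m` then pulls out `Q ^ j`. -/
theorem one_sub_mul_eulerSum {Q : ℤ⟦X⟧} (hQ : X ∣ Q) {j : ℕ} (hj : 1 ≤ j) :
    (1 - Q ^ j) * eulerSum Q j = eulerSum Q (j + 1) := by
  have h1 := summable_pow_mul hQ hj (invPochhammer Q)
  have h2 := summable_pow_mul hQ (Nat.le_add_left 1 j) (invPochhammer Q)
  have h : eulerSum Q j - eulerSum Q (j + 1) = Q ^ j * eulerSum Q j := by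
    rw [eulerSum, eulerSum, ← h1.tsum_sub h2, ← h1.tsum_mul_left, (h1.sub h2).tsum_eq_zero_add]
    simp only [mul_zero, pow_zero, sub_self, zero_add]
    refine tsum_congr fun m => ?_
    rw [← invPochhammer_succ_mul hQ m]
    ring
  linear_combination h

theorem X_pow_dvd_eulerSum_sub_one {Q : ℤ⟦X⟧} (hQ : X ∣ Q) {j : ℕ} (hj : 1 ≤ j) :
    X ^ j ∣ eulerSum Q j - 1 := by
  have h1 := summable_pow_mul hQ hj (invPochhammer Q)
  have h2 := summable_pow_mul hQ hj (fun m => invPochhammer Q (m + 1))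
  have h : eulerSum Q j = 1 + Q ^ j * ∑' m, Q ^ (j * m) * invPochhammer Q (m + 1) := by
    rw [eulerSum, ← h2.tsum_mul_left, h1.tsum_eq_zero_add]
    simp only [mul_zero, pow_zero, invPochhammer_zero, mul_one]
    congr 1
    exact tsum_congr fun m => by ring
  rw [h, add_sub_cancel_left]
  exact (pow_dvd_pow_of_dvd hQ j).mul_right _

theorem eulerSum_one_mul_prod {Q : ℤ⟦X⟧} (hQ : X ∣ Q) (n : ℕ) :
    eulerSum Q 1 * ∏ i ∈ Finset.range n, (1 - Q ^ (i + 1)) = eulerSum Q (n + 1) := by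
  induction n with
  | zero => simp
  | succ n ih =>
    rw [Finset.prod_range_succ, ← mul_assoc, ih, mul_comm,
      one_sub_mul_eulerSum hQ (Nat.le_add_left 1 n)]

theorem eulerSum_one_eq_invPochhammer_mul {Q : ℤ⟦X⟧} (hQ : X ∣ Q) (n : ℕ) :
    invPochhammer Q n * eulerSum Q (n + 1) = eulerSum Q 1 := by
  induction n with
  | zero => simp [invPochhammer_zero]
  | succ n ih =>
    rw [← one_sub_mul_eulerSum hQ (Nat.le_add_left 1 n), ← mul_assoc, invPochhammer_succ_mul hQ, ih]

theorem one_sub_mul_eulerSum_one {Q : ℤ⟦X⟧} (hQ : X ∣ Q) :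
    (1 - Q) * eulerSum Q 1 = 1 + Q ^ 2 * tail Q 0 := by
  have h1 := summable_pow_mul hQ one_le_two (invPochhammer Q)
  have h2 := summable_pow_mul hQ one_le_two (fun m => geom Q (m + 1) * invPochhammer Q m)
  have h := one_sub_mul_eulerSum hQ le_rfl
  rw [pow_one, one_add_one_eq_two] at h
  simp only [tail, invPochhammer_zero, zero_add, add_zero, one_mul]
  rw [h, eulerSum, ← h2.tsum_mul_left, h1.tsum_eq_zero_add]
  simp only [mul_zero, pow_zero, invPochhammer_zero, mul_one]
  congr 1
  refine tsum_congr fun m => ?_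
  rw [invPochhammer_succ]
  ring

/-! ### The truncated pentagonal number theorem -/

/-- The two-term recurrence of the Andrews–Merca tails. -/
theorem tail_add_tail_succ {Q : ℤ⟦X⟧} (hQ : X ∣ Q) (k : ℕ) :
    tail Q k + Q ^ (3 * k + 5) * tail Q (k + 1) = (1 - Q ^ (2 * k + 3)) * eulerSum Q 1 := by
  have hk : 1 ≤ k + 2 := by omega
  have hk' : 1 ≤ k + 3 := by omega
  have s1 := summable_pow_mul hQ hk (fun m => geom Q (m + k + 1) * invPochhammer Q m)
  have s2 := summable_pow_mul hQ hk' (fun m => geom Q (m + (k + 1) + 1) * invPochhammer Q m)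
  have s3 := summable_pow_mul hQ hk
    (fun m => Q ^ m * (1 - Q ^ m) * geom Q (m + k + 1) * invPochhammer Q m)
  have s4 := summable_pow_mul hQ hk (invPochhammer Q)
  have s5 := summable_pow_mul hQ hk' (invPochhammer Q)
  have shift : Q ^ (k + 3) * ∑' m, Q ^ ((k + 3) * m) *
      (geom Q (m + (k + 1) + 1) * invPochhammer Q m) =
      ∑' m, Q ^ ((k + 2) * m) *
        (Q ^ m * (1 - Q ^ m) * geom Q (m + k + 1) * invPochhammer Q m) := by
    rw [← s2.tsum_mul_left, s3.tsum_eq_zero_add]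
    simp only [mul_zero, pow_zero, sub_self, zero_mul, zero_add]
    refine tsum_congr fun m => ?_
    rw [← invPochhammer_succ_mul hQ m, show m + (k + 1) + 1 = m + 1 + k + 1 by ring]
    ring
  have split : (1 - Q ^ (k + 1)) * (∑' m, Q ^ ((k + 2) * m) *
        (geom Q (m + k + 1) * invPochhammer Q m)) +
      Q ^ (2 * k + 2) * (∑' m, Q ^ ((k + 2) * m) *
        (Q ^ m * (1 - Q ^ m) * geom Q (m + k + 1) * invPochhammer Q m)) =
      (1 - Q ^ (k + 1)) * eulerSum Q (k + 2) + Q ^ (k + 1) * eulerSum Q (k + 3) := by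
    rw [eulerSum, eulerSum, ← s1.tsum_mul_left, ← s3.tsum_mul_left, ← s4.tsum_mul_left,
      ← s5.tsum_mul_left, ← (s1.mul_left _).tsum_add (s3.mul_left _),
      ← (s4.mul_left _).tsum_add (s5.mul_left _)]
    refine tsum_congr fun m => ?_
    have hg := geom_mul hQ (Nat.succ_ne_zero (m + k))
    simp only [Nat.succ_eq_add_one] at hg
    -- With `a = Q ^ (k + 1)` and `y = Q ^ m`: `(1 - a) + a² y (1 - y) = (1 - a y) (1 - a + a y)`,
    -- and `geom` inverts `1 - a y`.
    linear_combination Q ^ ((k + 2) * m) * invPochhammer Q m *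
      (1 - Q ^ (k + 1) + Q ^ (k + 1) * Q ^ m) * hg
  have e1 := eulerSum_one_eq_invPochhammer_mul hQ (k + 1)
  have e2 := one_sub_mul_eulerSum hQ hk
  have e3 := invPochhammer_succ_mul hQ k
  simp only [tail]
  rw [← e3]
  rw [show k + 1 + 1 = k + 2 by ring] at e1
  rw [show k + 2 + 1 = k + 3 by ring] at e2
  rw [show k + 1 + 2 = k + 3 by ring]
  linear_combination invPochhammer Q (k + 1) * split +
    invPochhammer Q (k + 1) * Q ^ (2 * k + 2) * shift -
    invPochhammer Q (k + 1) * Q ^ (k + 1) * e2 + (1 - Q ^ (2 * k + 3)) * e1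

/-- The Andrews–Merca truncated pentagonal number theorem. -/
theorem truncated_pentagonal {Q : ℤ⟦X⟧} (hQ : X ∣ Q) {R : ℤ⟦X⟧} (hR : R ^ 2 = Q) (k : ℕ) :
    (∑ i ∈ Finset.range (k + 1), (-1) ^ i *
      (R ^ (i * (3 * i + 1)) - R ^ ((i + 1) * (3 * i + 2)))) * eulerSum Q 1 =
      1 + (-1) ^ k * R ^ ((k + 1) * (3 * k + 4)) * tail Q k := by
  induction k with
  | zero =>
    have h := one_sub_mul_eulerSum_one hQ
    simp only [← hR] at h ⊢
    simp only [zero_add, Finset.sum_range_one]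
    linear_combination h
  | succ k ih =>
    have h := tail_add_tail_succ hQ k
    rw [Finset.sum_range_succ, add_mul, ih]
    simp only [← hR] at h ⊢
    -- The new pair of pentagonal terms is `R ^ ((k + 1) * (3 * k + 4)) * (1 - Q ^ (2 * k + 3))`,
    -- which matches the recurrence.
    linear_combination (-1) ^ k * R ^ ((k + 1) * (3 * k + 4)) * h

/-! ### Nonnegativity and constant terms -/

/-- Power series with nonnegative coefficients. -/
def NonnegCoeffs (f : ℤ⟦X⟧) : Prop := ∀ n, 0 ≤ coeff n f

theorem NonnegCoeffs.mul {f g : ℤ⟦X⟧} (hf : NonnegCoeffs f) (hg : NonnegCoeffs g) :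
    NonnegCoeffs (f * g) := fun n => by
  rw [coeff_mul]
  exact Finset.sum_nonneg fun x _ => mul_nonneg (hf x.1) (hg x.2)

theorem nonnegCoeffs_one : NonnegCoeffs 1 := fun n => by
  rw [coeff_one]; split_ifs <;> norm_num

theorem nonnegCoeffs_X : NonnegCoeffs X := fun n => by
  rw [coeff_X]; split_ifs <;> norm_num

theorem NonnegCoeffs.pow {f : ℤ⟦X⟧} (hf : NonnegCoeffs f) (m : ℕ) : NonnegCoeffs (f ^ m) := by
  induction m with
  | zero => simpa using nonnegCoeffs_one
  | succ m ih => simpa [pow_succ] using ih.mul hf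

theorem nonnegCoeffs_tsum {f : ℕ → ℤ⟦X⟧} (hs : Summable f) (hf : ∀ m, NonnegCoeffs (f m)) :
    NonnegCoeffs (∑' m, f m) := fun n => by
  rw [hs.map_tsum _ (WithPiTopology.continuous_coeff ℤ n)]
  exact tsum_nonneg fun m => hf m n

theorem coeff_zero_tsum {f : ℕ → ℤ⟦X⟧} (h : ∀ m, X ^ m ∣ f m) :
    coeff 0 (∑' m, f m) = coeff 0 (f 0) := by
  rw [(summable_of_X_pow_dvd h).map_tsum _ (WithPiTopology.continuous_coeff ℤ 0)]
  refine tsum_eq_single 0 fun m hm => ?_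
  exact X_pow_dvd_iff.mp (h m) 0 (Nat.pos_of_ne_zero hm)

theorem nonnegCoeffs_geom {Q : ℤ⟦X⟧} (hQ : X ∣ Q) (h : NonnegCoeffs Q) {i : ℕ} (hi : i ≠ 0) :
    NonnegCoeffs (geom Q i) := by
  refine nonnegCoeffs_tsum (summable_of_X_pow_dvd fun m => ?_) fun m => (h.pow i).pow m
  exact pow_dvd_pow_of_dvd (hQ.trans (dvd_pow_self Q hi)) m

theorem nonnegCoeffs_invPochhammer {Q : ℤ⟦X⟧} (hQ : X ∣ Q) (h : NonnegCoeffs Q) (m : ℕ) :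
    NonnegCoeffs (invPochhammer Q m) := by
  induction m with
  | zero => simpa [invPochhammer_zero] using nonnegCoeffs_one
  | succ m ih =>
    rw [invPochhammer_succ]
    exact ih.mul (nonnegCoeffs_geom hQ h m.succ_ne_zero)

theorem nonnegCoeffs_tail {Q : ℤ⟦X⟧} (hQ : X ∣ Q) (h : NonnegCoeffs Q) (k : ℕ) :
    NonnegCoeffs (tail Q k) := by
  refine (nonnegCoeffs_invPochhammer hQ h k).mul
    (nonnegCoeffs_tsum (summable_pow_mul hQ (by omega) _) fun m => ?_)
  exact (h.pow _).mul
    ((nonnegCoeffs_geom hQ h (Nat.succ_ne_zero _)).mul (nonnegCoeffs_invPochhammer hQ h m))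

theorem coeff_zero_geom {Q : ℤ⟦X⟧} (hQ : X ∣ Q) {i : ℕ} (hi : i ≠ 0) :
    coeff 0 (geom Q i) = 1 := by
  rw [geom, coeff_zero_tsum fun m => pow_dvd_pow_of_dvd (hQ.trans (dvd_pow_self Q hi)) m]
  simp

theorem coeff_zero_tail {Q : ℤ⟦X⟧} (hQ : X ∣ Q) (k : ℕ) : coeff 0 (tail Q k) = 1 := by
  have h : coeff 0 (invPochhammer Q k) = 1 := by
    induction k with
    | zero => simp [invPochhammer_zero]
    | succ k ih =>
      have := coeff_zero_geom hQ k.succ_ne_zero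
      simp_all [invPochhammer_succ]
  have hs := coeff_zero_tsum fun m => X_pow_dvd_pow_mul hQ (Nat.le_add_left 1 (k + 1)) m
    (geom Q (m + k + 1) * invPochhammer Q m)
  have hg := coeff_zero_geom hQ (Nat.succ_ne_zero (0 + k))
  simp only [tail, invPochhammer_zero] at hs ⊢
  simp_all

/-! ### Partition generating functions -/

/-- The generating function of the partitions whose parts satisfy `p`. -/
noncomputable def restrictedSeries (p : ℕ → Prop) [DecidablePred p] : ℤ⟦X⟧ :=
  PowerSeries.mk fun n => ((Nat.Partition.restricted n p).card : ℤ)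

theorem hasProd_one_sub_X_pow_mul_eulerSum {l : ℕ} (hl : 0 < l) :
    ∃ D : ℤ⟦X⟧, HasProd (fun i : ℕ => if l ∣ i + 1 then 1 - X ^ (i + 1) else 1) D ∧
      eulerSum (X ^ l) 1 * D = 1 := by
  have hQ : (X : ℤ⟦X⟧) ∣ X ^ l := dvd_pow_self X hl.ne'
  have hm : Multipliable fun i : ℕ => 1 - ((X : ℤ⟦X⟧) ^ l) ^ (i + 1) := by
    simp_rw [sub_eq_add_neg]
    apply WithPiTopology.multipliable_one_add_of_tendsto_order_atTop_nhds_top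
    refine ENat.tendsto_nhds_top_iff_natCast_lt.mpr fun n => Filter.eventually_atTop.mpr
      ⟨n, fun m hm => ?_⟩
    rw [order_neg, ← pow_mul, order_X_pow]
    norm_cast
    nlinarith
  obtain ⟨D, hD⟩ := hm
  refine ⟨D, ?_, ?_⟩
  -- Factor `i` belongs to part size `i + 1`, so the multiples of `l` sit at the indices `l * (i +
  -- 1) - 1`.
  · have hinj : Function.Injective fun i : ℕ => l * (i + 1) - 1 := fun a b h => by
      have ha := Nat.mul_pos hl a.succ_pos
      have hb := Nat.mul_pos hl b.succ_pos
      have : l * (a + 1) = l * (b + 1) := by simp only [Nat.succ_eq_add_one] at *; omega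
      simpa using Nat.eq_of_mul_eq_mul_left hl this
    refine (hinj.hasProd_iff fun x hx => if_neg fun hd => hx ?_).mp ?_
    · obtain ⟨_ | c, hc⟩ := hd
      · simp at hc
      · exact ⟨c, by simp only [← hc]; omega⟩
    · convert! hD using 1
      ext1 i
      have := Nat.mul_pos hl i.succ_pos
      simp only [Nat.succ_eq_add_one] at this
      simp [Nat.sub_add_cancel this, pow_mul]
  · have h1 := hD.tendsto_prod_nat.const_mul (eulerSum (X ^ l) 1)
    simp_rw [eulerSum_one_mul_prod hQ] at h1
    refine tendsto_nhds_unique h1 ?_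
    rw [WithPiTopology.tendsto_iff_coeff_tendsto]
    refine fun d => tendsto_atTop_of_eventually_const (i₀ := d) fun n hn => ?_
    rw [← sub_eq_zero, ← map_sub]
    exact X_pow_dvd_iff.mp (X_pow_dvd_eulerSum_sub_one hQ (Nat.le_add_left 1 n)) d (by omega)

theorem restrictedSeries_not_dvd_mul_eulerSum {l : ℕ} (hl : 0 < l) :
    restrictedSeries (fun i => ¬ l ∣ i) * eulerSum (X ^ l) 1 = restrictedSeries fun _ => True := by
  obtain ⟨D, hD, h1⟩ := hasProd_one_sub_X_pow_mul_eulerSum hl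
  have hB := Nat.Partition.hasProd_powerSeriesMk_card_restricted ℤ (fun i => ¬ l ∣ i)
  have hP := Nat.Partition.hasProd_powerSeriesMk_card_restricted ℤ (fun _ => True)
  have h : restrictedSeries (fun i => ¬ l ∣ i) = restrictedSeries (fun _ => True) * D := by
    refine hB.unique ?_
    convert! hP.mul hD using 2 with i
    by_cases hi : l ∣ i + 1
    · have := WithPiTopology.tsum_pow_mul_one_sub_of_constantCoeff_eq_zero
        (f := (X : ℤ⟦X⟧) ^ (i + 1)) (by simp)
      simp_rw [pow_mul]
      simp [hi, this]
    · simp [hi]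
  rw [h, mul_assoc, mul_comm D, h1, mul_one]

theorem coeff_X_pow_mul_restrictedSeries_true (a n : ℕ) :
    coeff n (X ^ a * restrictedSeries fun _ => True) = (partitionCount ((n : ℤ) - a) : ℤ) := by
  rw [coeff_X_pow_mul', partitionCount]
  by_cases h : a ≤ n
  · have h2 : ((n : ℤ) - a).toNat = n - a := by omega
    simp [h, h2, restrictedSeries, Nat.Partition.restricted, Finset.card_univ]
  · have h' : ¬ (0 : ℤ) ≤ (n : ℤ) - a := by omega
    simp only [if_neg h, if_neg h', Nat.cast_zero]

/-- Index `i` on the right collects the pair `j = -i` and `j = i + 1` on the left. -/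
theorem sum_partitionCount_eq_coeff (k n : ℕ) :
    ∑ j ∈ Finset.Icc (-(((k + 1 : ℕ) : ℤ) - 1)) ((k + 1 : ℕ) : ℤ),
      (Int.negOnePow j : ℤ) * (partitionCount ((n : ℤ) - 3 * j * (3 * j - 1)) : ℤ) =
    coeff n ((∑ i ∈ Finset.range (k + 1), (-1) ^ i *
      ((X ^ 3) ^ (i * (3 * i + 1)) - (X ^ 3) ^ ((i + 1) * (3 * i + 2)))) *
        restrictedSeries fun _ => True) := by
  have term (i : ℕ) : coeff n ((-1) ^ i *
      ((X ^ 3) ^ (i * (3 * i + 1)) - (X ^ 3) ^ ((i + 1) * (3 * i + 2))) *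
        restrictedSeries fun _ => True) =
      (Int.negOnePow (-(i : ℤ)) : ℤ) *
        (partitionCount ((n : ℤ) - 3 * (-(i : ℤ)) * (3 * (-(i : ℤ)) - 1)) : ℤ) +
      (Int.negOnePow ((i : ℤ) + 1) : ℤ) *
        (partitionCount ((n : ℤ) - 3 * ((i : ℤ) + 1) * (3 * ((i : ℤ) + 1) - 1)) : ℤ) := by
    have hC : ((-1 : ℤ⟦X⟧)) ^ i = C ((-1 : ℤ) ^ i) := by simp
    rw [hC, mul_assoc, coeff_C_mul, sub_mul, map_sub, ← pow_mul, ← pow_mul,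
      coeff_X_pow_mul_restrictedSeries_true, coeff_X_pow_mul_restrictedSeries_true,
      Int.negOnePow_neg, Int.negOnePow_succ, Int.negOnePow_def, zpow_natCast]
    push_cast
    ring_nf
  induction k with
  | zero =>
    have h : Finset.Icc (-(((0 + 1 : ℕ) : ℤ) - 1)) ((0 + 1 : ℕ) : ℤ) = {0, 1} := by decide
    rw [h, Finset.sum_pair zero_ne_one, zero_add, Finset.sum_range_one, term]
    simp
  | succ k ih =>
    have h : Finset.Icc (-(((k + 1 + 1 : ℕ) : ℤ) - 1)) ((k + 1 + 1 : ℕ) : ℤ) =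
        insert (-((k + 1 : ℕ) : ℤ)) (insert (((k + 1 : ℕ) : ℤ) + 1)
          (Finset.Icc (-(((k + 1 : ℕ) : ℤ) - 1)) ((k + 1 : ℕ) : ℤ))) := by
      ext x
      simp only [Finset.mem_Icc, Finset.mem_insert]
      omega
    rw [h, Finset.sum_insert, Finset.sum_insert, ih, Finset.sum_range_succ _ (k + 1), add_mul, map_add, term]
    · ring
    · simp only [Finset.mem_Icc]; omega
    · simp only [Finset.mem_Icc, Finset.mem_insert]; omega

theorem truncatedDifference_succ (k n : ℕ) :
    truncatedDifference (k + 1) n = coeff n (X ^ (3 * (k + 1) * (3 * k + 4)) *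
      (restrictedSeries (fun i => ¬ 6 ∣ i) * tail (X ^ 6) k)) := by
  have hQ : (X : ℤ⟦X⟧) ∣ X ^ 6 := dvd_pow_self X (by norm_num)
  have ht := truncated_pentagonal hQ (R := X ^ 3) (by ring) k
  have hB : (regularPartitionCount 6 n : ℤ) = coeff n (restrictedSeries fun i => ¬ 6 ∣ i) := by
    simp [restrictedSeries, regularPartitionCount]
  rw [truncatedDifference, sum_partitionCount_eq_coeff, hB, ← map_sub,
    ← restrictedSeries_not_dvd_mul_eulerSum (by norm_num : 0 < 6), mul_left_comm, ht,
    ← coeff_C_mul]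
  congr 1
  have hs : ((-1 : ℤ⟦X⟧) ^ k) * (-1) ^ k = 1 := by rw [← mul_pow]; simp
  simp only [map_pow, map_neg, map_one]
  linear_combination (X ^ (3 * (k + 1) * (3 * k + 4)) *
      (restrictedSeries (fun i => ¬ 6 ∣ i) * tail (X ^ 6) k)) * hs

theorem nonnegCoeffs_restrictedSeries (p : ℕ → Prop) [DecidablePred p] :
    NonnegCoeffs (restrictedSeries p) := fun n => by simp [restrictedSeries]

theorem coeff_restrictedSeries_pos {p : ℕ → Prop} [DecidablePred p] (hp : p 1) (n : ℕ) :
    0 < coeff n (restrictedSeries p) := by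
  simp only [restrictedSeries, coeff_mk, Nat.cast_pos, Finset.card_pos]
  refine ⟨⟨Multiset.replicate n 1, fun h => ?_, by simp⟩, ?_⟩
  · simp [Multiset.eq_of_mem_replicate h]
  · simp only [Nat.Partition.restricted, Finset.mem_filter, Finset.mem_univ, true_and]
    intro i hi
    rwa [Multiset.eq_of_mem_replicate hi]

theorem truncatedDifference_succ_nonneg (k n : ℕ) : 0 ≤ truncatedDifference (k + 1) n := by
  rw [truncatedDifference_succ]
  exact (nonnegCoeffs_X.pow _).mul ((nonnegCoeffs_restrictedSeries _).mul
    (nonnegCoeffs_tail (dvd_pow_self X (by norm_num)) (nonnegCoeffs_X.pow 6) k)) n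

theorem truncatedDifference_succ_pos {k n : ℕ} (h : 3 * (k + 1) * (3 * k + 4) ≤ n) :
    0 < truncatedDifference (k + 1) n := by
  have hQ : (X : ℤ⟦X⟧) ∣ X ^ 6 := dvd_pow_self X (by norm_num)
  have ht := nonnegCoeffs_tail hQ (nonnegCoeffs_X.pow 6) k
  rw [truncatedDifference_succ, coeff_X_pow_mul', if_pos h, coeff_mul]
  -- One positive term of the convolution suffices: the one using the constant term 1 of the tail.
  refine Finset.sum_pos' (fun x _ => mul_nonneg (nonnegCoeffs_restrictedSeries _ _) (ht _))
    ⟨(n - 3 * (k + 1) * (3 * k + 4), 0), by simp, ?_⟩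
  rw [coeff_zero_tail hQ, mul_one]
  exact coeff_restrictedSeries_pos (by norm_num) _

end TruncatedPentagonal

open TruncatedPentagonal

theorem mainTheorem7 :
    (∀ n k : ℕ, 0 < k →
      0 ≤ truncatedDifference k n ∧
      (3 * k * (3 * k + 1) ≤ n → 0 < truncatedDifference k n)) ∧
    (∀ n : ℕ,
      (partitionCount (n : ℤ) : ℤ) - partitionCount ((n : ℤ) - 6)
          - partitionCount ((n : ℤ) - 12) + partitionCount ((n : ℤ) - 30)
        ≤ (regularPartitionCount 6 n : ℤ) ∧
      (regularPartitionCount 6 n : ℤ)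
        ≤ (partitionCount (n : ℤ) : ℤ) - partitionCount ((n : ℤ) - 6)) := by
  refine ⟨fun n k hk => ?_, fun n => ⟨?_, ?_⟩⟩
  · obtain ⟨k, rfl⟩ := Nat.exists_eq_add_one_of_ne_zero hk.ne'
    exact ⟨truncatedDifference_succ_nonneg k n, fun h => truncatedDifference_succ_pos h⟩
  · have h := truncatedDifference_succ_nonneg 1 n
    have hI : Finset.Icc (-(((1 + 1 : ℕ) : ℤ) - 1)) ((1 + 1 : ℕ) : ℤ) = {-1, 0, 1, 2} := by decide
    rw [truncatedDifference, hI] at h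
    have h2 : Int.negOnePow 2 = 1 := Int.negOnePow_even 2 (by decide)
    norm_num [h2, Int.negOnePow_neg] at h
    linarith
  · have h := truncatedDifference_succ_nonneg 0 n
    have hI : Finset.Icc (-(((0 + 1 : ℕ) : ℤ) - 1)) ((0 + 1 : ℕ) : ℤ) = {0, 1} := by decide
    rw [truncatedDifference, hI] at h
    norm_num at h
    linarith
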